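/- Let $N$ be a smooth manifold of dimension $n\ge 2$ oriented by a volume form $v$, let $p_M\colon M\to N$ be the bundle of pseudo-Riemannian metrics of a fixed signature $(n^+,n^-)$, $n^++n^-=n$, and let $\mathcal A(TN)\subset p_M^*\operatorname{End}(TN)$ be the subbundle of pairs $(g_x,A)$ such that $A$ is skew-symmetric with respect to $g_x$. Let $\beta$ be a smooth $\mathcal A(TN)$-valued $p_M$-horizontal $(n-2)$-form on $M$. Notation. For a volume form $u$ on $N$ put $\phi^1_u(X)=i_Xu$ and $\phi^2_u(X\wedge Y)=i_Xi_Yu$, with $X\wedge Y=X\otimes Y-Y\otimes X$. For a metric $g$ (a smooth section of $p_M$), $\nabla^g$ is its Levi-Civita connection, $R^g$ its curvature, $d^{\nabla^g}$ the exterior covariant derivative, and $\sharp$ raises the covariant index of $\operatorname{End}(TN)=T^*N\otimes TN$ by means of $g$, the raised index being the first factor of $TN\otimes TN$. The *generalized BF Euler–Lagrange equations* for $g$ are $$g^*(d_{M/N}\beta)\barwedge R^g+\operatorname{sym}_{12}\circ d^{\nabla^g}\bigl(\omega_{n-1}(g,\beta)\bigr)=0,\qquad(\mathrm{EL})$$ where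 * $d_{M/N}\beta$ is the derivative of $\beta$ along the fibres of $p_M$, its value on covectors $(w_1,w_2)$ being the derivative in the direction $w_1\otimes w_2+w_2\otimes w_1$, and $$\bigl(g^*(d_{M/N}\beta)\barwedge R^g\bigr)(w_1,w_2,X_1,\dots,X_n)=\sum_{k<l}(-1)^{k+l+1}\operatorname{trace}\bigl\{g^*(d_{M/N}\beta)(w_1,w_2,X_1,\dots,\widehat{X_k},\dots,\widehat{X_l},\dots,X_n)\circ R^g(X_k,X_l)\bigr\};$$ * $\omega_{n-1}(g,\beta)=\bigl((\phi^1_v)^{-1}\otimes\operatorname{id}_{TN}\otimes\phi^1_v\bigr)\bigl(d^{\nabla^g}(g^*\beta)^\sharp\bigr)$, a $(TN\otimes TN)$-valued $(n-1)$-form; * $\operatorname{sym}_{12}(X\otimes Y)=X\otimes Y+Y\otimes X$. For a volume form $w$ on $N$ let $\tilde\beta=\bigl((\phi^2_w)^{-1}\otimes\operatorname{id}\bigr)\circ\beta$, a section of $p_M^*(\wedge^2TN)\otimes\mathcal A(TN)$, so that $\tilde\beta^\sharp\circ g$ is a section of $\otimes^4TN$ (the third factor being the raised index). Let $\operatorname{sym}_{14}(X_1\otimes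 X_2\otimes X_3\otimes X_4)=X_1\otimes X_2\otimes X_3\otimes X_4+X_4\otimes X_2\otimes X_3\otimes X_1$, and let $c^{23}_{12}\colon\otimes^2T^*N\otimes^4TN\to\otimes^2TN$ contract the first covariant index with the second contravariant one and the second covariant index with the third contravariant one. **Statement.** Let $g$ be a flat metric of signature $(n^+,n^-)$ on $N$ (that is, $R^g=0$), and let $\tilde\beta$ be formed with a volume form $w$ that is parallel, $\nabla^gw=0$ (for instance the volume form $v_g$ of $g$; or $v$ itself, if $v$ has constant coefficient in the local coordinates in which $g$ is constant). Then $g$ is a solution of (EL) if and only if $$c^{23}_{12}\Bigl[(\nabla^g)^2\bigl\{\operatorname{sym}_{14}(\tilde\beta^\sharp\circ g)\bigr\}\Bigr]=0.$$ -/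

import Mathlib

open scoped Manifold ContDiff

noncomputable section

namespace BFTheory

/-! ### Pointwise linear algebra -/

/-- The model space `ℝⁿ`, with `n = d + 2`. -/
abbrev Coord (d : ℕ) : Type := EuclideanSpace ℝ (Fin (d + 2))

/-- The coordinate vector `∂_i`. -/
def pd {d : ℕ} (i : Fin (d + 2)) : Coord d := EuclideanSpace.single i 1

/-- Bilinear forms on a tangent space. -/
abbrev Bilin (V : Type*) [AddCommGroup V] [Module ℝ V] [TopologicalSpace V] : Type _ :=
  V →L[ℝ] V →L[ℝ] ℝ

/-- The pull-back of a bilinear form `h` by a linear map `L`: `(X, Y) ↦ h (L X) (L Y)`. -/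
def pullBilin {V W : Type*} [AddCommGroup V] [Module ℝ V] [TopologicalSpace V]
    [AddCommGroup W] [Module ℝ W] [TopologicalSpace W] (h : Bilin W) (L : V →L[ℝ] W) : Bilin V :=
  (ContinuousLinearMap.precomp ℝ L).comp (h.comp L)

/-- `h` is a scalar product of signature `(p, q)`: an element of the fibre of the bundle `M` of
pseudo-Riemannian metrics of signature `(p, q)`. -/
structure IsMetricForm {V : Type*} [AddCommGroup V] [Module ℝ V] [TopologicalSpace V]
    (p q : ℕ) (h : Bilin V) : Prop where
  symm : ∀ X Y, h X Y = h Y X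
  nondegenerate : ∀ X, (∀ Y, h X Y = 0) → X = 0
  sigPos_eq : _root_.sigPos (LinearMap.BilinMap.toQuadraticMap h.toBilinForm) = p
  sigNeg_eq : _root_.sigNeg (LinearMap.BilinMap.toQuadraticMap h.toBilinForm) = q

/-- `φ_v¹(X) = i_X v`, as a function of `n - 1` vectors. -/
def phi1 {d : ℕ} (v : (Fin (d + 2) → Coord d) → ℝ) (X : Coord d) :
    (Fin (d + 1) → Coord d) → ℝ :=
  fun u => v (Fin.cons X u)

/-- `(φ_v¹)⁻¹`: the components of the vector `X` with `i_X v = η`. -/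
def phi1Inv {d : ℕ} (v : (Fin (d + 2) → Coord d) → ℝ) (η : (Fin (d + 1) → Coord d) → ℝ)
    (l : Fin (d + 2)) : ℝ :=
  (-1) ^ (l : ℕ) * η (fun s => pd (l.succAbove s)) / v pd

/-- The vectors `u` with those of index `k < l` omitted (`k : Fin (d + 1)` stands for the
index `k.castSucc`). -/
def omitTwo {d : ℕ} {V : Type*} (u : Fin (d + 2) → V) (l : Fin (d + 2)) (k : Fin (d + 1)) :
    Fin d → V :=
  fun s => u (l.succAbove (k.succAbove s))

/-- `(φ_v²)⁻¹`, where `φ_v²(X ∧ Y) = i_X i_Y v`: the components of the bivector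
`∑_{k<l} (-1)^{k+l} η_{kl} / v(∂_1, …, ∂_n) ∂_k ∧ ∂_l`, where `η_{kl}` is the value of `η` on the
coordinate vectors other than `∂_k` and `∂_l`, and `∂_k ∧ ∂_l = ∂_k ⊗ ∂_l - ∂_l ⊗ ∂_k`. -/
def phi2Inv {d : ℕ} (v : (Fin (d + 2) → Coord d) → ℝ) (η : (Fin d → Coord d) → ℝ)
    (a b : Fin (d + 2)) : ℝ :=
  ∑ l : Fin (d + 2), ∑ k : Fin (d + 1), if k.castSucc < l then
    (-1) ^ ((k : ℕ) + (l : ℕ)) * η (omitTwo pd l k) / v pd *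
      ((if a = k.castSucc ∧ b = l then 1 else 0) - (if a = l ∧ b = k.castSucc then 1 else 0))
  else 0

/-! ### Tensor calculus of a metric in coordinates -/

/-- A field of bilinear forms in coordinates. -/
abbrev MetricField (d : ℕ) : Type := Coord d → Bilin (Coord d)

/-- An `n`-form in coordinates, as a function of the point and of `n` vectors. -/
abbrev VolField (d : ℕ) : Type := Coord d → (Fin (d + 2) → Coord d) → ℝ

/-- An `End(TN)`-valued horizontal `(n - 2)`-form on the bundle of metrics, in coordinates: a
function of the point, the metric at that point, and `n - 2` vectors. -/
abbrev BField (d : ℕ) : Type :=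
  Coord d → Bilin (Coord d) → (Fin d → Coord d) → (Coord d →L[ℝ] Coord d)

/-- Components of contravariant `2`-tensors. -/
abbrev Tens2 (d : ℕ) : Type := Fin (d + 2) → Fin (d + 2) → ℝ

/-- Components of contravariant `4`-tensors. -/
abbrev Tens4 (d : ℕ) : Type :=
  Fin (d + 2) → Fin (d + 2) → Fin (d + 2) → Fin (d + 2) → ℝ

variable {d : ℕ}

/-- The components `g_ij`. -/
def lower (g : MetricField d) (i j : Fin (d + 2)) (y : Coord d) : ℝ := g y (pd i) (pd j)

/-- The components `g^ij` of the inverse metric. -/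
def upper (g : MetricField d) (i j : Fin (d + 2)) (y : Coord d) : ℝ :=
  (Matrix.of fun a b => lower g a b y)⁻¹ i j

/-- The partial derivative `∂f/∂x^i`. -/
def partialD (i : Fin (d + 2)) (f : Coord d → ℝ) (y : Coord d) : ℝ := fderiv ℝ f y (pd i)

/-- The Christoffel symbol `Γ^k_{ij}` of the Levi-Civita connection of `g`. -/
def christoffel (g : MetricField d) (k i j : Fin (d + 2)) (y : Coord d) : ℝ :=
  (1 / 2) * ∑ l, upper g k l y *
    (partialD i (lower g j l) y + partialD j (lower g i l) y - partialD l (lower g i j) y)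

/-- The components `R^i_{jkl}` of the curvature, `R(∂_k, ∂_l) ∂_j = R^i_{jkl} ∂_i`. -/
def curvature (g : MetricField d) (i j k l : Fin (d + 2)) (y : Coord d) : ℝ :=
  partialD k (christoffel g i j l) y - partialD l (christoffel g i j k) y
    + ∑ m, (christoffel g m j l y * christoffel g i k m y
        - christoffel g m j k y * christoffel g i l m y)

/-- The endomorphism `R(X, Y)`, as a matrix. -/
def curvatureEnd (g : MetricField d) (y X Y : Coord d) :
    Matrix (Fin (d + 2)) (Fin (d + 2)) ℝ :=
  Matrix.of fun i j => ∑ k, ∑ l, curvature g i j k l y * X k * Y l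

/-- The connection matrix `Γ(X)^a_m = Γ^a_{im} X^i`, so that
`∇_X (s^m ∂_m) = (X(s^a) + Γ(X)^a_m s^m) ∂_a`. -/
def connMat (g : MetricField d) (y X : Coord d) (a m : Fin (d + 2)) : ℝ :=
  ∑ i, X i * christoffel g a i m y

/-- The exterior covariant derivative `d^∇ η` of a `(TN ⊗ TN)`-valued `k`-form `η`, evaluated on
`u_0, …, u_k` (extended as constant, hence commuting, coordinate vector fields):
`∑_s (-1)^s ∇_{u_s} (η(u_0, …, û_s, …, u_k))`. -/
def extCovD (g : MetricField d) {k : ℕ} (η : Coord d → (Fin k → Coord d) → Tens2 d)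
    (y : Coord d) (u : Fin (k + 1) → Coord d) : Tens2 d :=
  fun a b => ∑ s : Fin (k + 1), (-1) ^ (s : ℕ) *
    (fderiv ℝ (fun z => η z (s.removeNth u) a b) y (u s)
      + ∑ m, connMat g y (u s) a m * η y (s.removeNth u) m b
      + ∑ m, connMat g y (u s) b m * η y (s.removeNth u) a m)

/-- The symmetrization `sym_12 (X ⊗ Y) = X ⊗ Y + Y ⊗ X`. -/
def sym12 (t : Tens2 d) : Tens2 d := fun a b => t a b + t b a

/-- The symmetrization `sym_14` of the arguments `1` and `4` of a contravariant `4`-tensor. -/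
def sym14 (t : Tens4 d) : Tens4 d := fun a b c e => t a b c e + t e b c a

/-- The covariant derivative of a contravariant `4`-tensor field: `(∇_r B)^{abce}`. -/
def nabla4 (g : MetricField d) (B : Coord d → Tens4 d) (y : Coord d) (r : Fin (d + 2)) :
    Tens4 d :=
  fun a b c e => partialD r (fun z => B z a b c e) y
    + ∑ m, (christoffel g a r m y * B y m b c e + christoffel g b r m y * B y a m c e
        + christoffel g c r m y * B y a b m e + christoffel g e r m y * B y a b c m)

/-- The second covariant derivative of a contravariant `4`-tensor field:
`(∇² B)_{rs}^{abce} = (∇_r (∇ B))_s^{abce}`. -/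
def nablaSq4 (g : MetricField d) (B : Coord d → Tens4 d) (y : Coord d) (r s : Fin (d + 2)) :
    Tens4 d :=
  fun a b c e => nabla4 g (fun z => nabla4 g B z s) y r a b c e
    - ∑ m, christoffel g m r s y * nabla4 g B y m a b c e

/-- The contraction `c^{23}_{12}` of the first covariant index with the second contravariant one
and of the second covariant index with the third contravariant one. -/
def contr2312 (T : Fin (d + 2) → Fin (d + 2) → Tens4 d) : Tens2 d :=
  fun a e => ∑ r, ∑ s, T r s a r s e

/-! ### The two equations in coordinates -/

/-- `(g^* β)^♯`, a `(TN ⊗ TN)`-valued `(n - 2)`-form; the first factor is the raised index. -/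
def betaSharp (g : MetricField d) (β : BField d) (y : Coord d) (u : Fin d → Coord d) : Tens2 d :=
  fun a b => ∑ m, upper g a m y * β y (g y) u (pd m) b

/-- `ω_{n-1}(g, β) = ((φ_v¹)⁻¹ ⊗ id ⊗ φ_v¹) (d^∇ (g^* β)^♯)`, a `(TN ⊗ TN)`-valued
`(n - 1)`-form. -/
def omega (g : MetricField d) (v : VolField d) (β : BField d) (y : Coord d)
    (u : Fin (d + 1) → Coord d) : Tens2 d :=
  fun l a => ∑ b, phi1Inv (v y) (fun w => extCovD g (betaSharp g β) y w a b) l *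
    phi1 (v y) (pd b) u

/-- The bilinear form `dx^a ⊗ dx^b`. -/
def dxdx (a b : Fin (d + 2)) : Bilin (Coord d) :=
  (EuclideanSpace.proj a : Coord d →L[ℝ] ℝ).smulRight (EuclideanSpace.proj b : Coord d →L[ℝ] ℝ)

/-- The fibre differential `g^*(d_{M/N} β)`, with values in `S²TN ⊗ End(TN)`: its value on the
covectors `dx^a, dx^b` and on `n - 2` vectors is the derivative of `β` along the fibre of the
bundle of metrics in the direction `dx^a ⊗ dx^b + dx^b ⊗ dx^a`. Endomorphisms are written as
matrices. -/
def fibreD (g : MetricField d) (β : BField d) (y : Coord d) (a b : Fin (d + 2))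
    (u : Fin d → Coord d) : Matrix (Fin (d + 2)) (Fin (d + 2)) ℝ :=
  Matrix.of fun i j => deriv (fun t : ℝ => β y (g y + t • (dxdx a b + dxdx b a)) u (pd j) i) 0

/-- The `S²TN`-valued `n`-form `g^*(d_{M/N} β) ⊼ R^g`. With indices starting from `0`, the sign is
`(-1)^{(k+1)+(l+1)+1} = (-1)^{k+l+1}`. -/
def barWedge (g : MetricField d) (β : BField d) (y : Coord d) (u : Fin (d + 2) → Coord d) :
    Tens2 d :=
  fun a b => ∑ l : Fin (d + 2), ∑ k : Fin (d + 1), if k.castSucc < l then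
    (-1) ^ ((k : ℕ) + (l : ℕ) + 1) *
      (fibreD g β y a b (omitTwo u l k) * curvatureEnd g y (u k.castSucc) (u l)).trace
  else 0

/-- The left-hand side `g^*(d_{M/N} β) ⊼ R^g + sym_12 ∘ d^∇ (ω_{n-1}(g, β))` of the
Euler–Lagrange equations. -/
def eulerLagrange (g : MetricField d) (v : VolField d) (β : BField d) (y : Coord d)
    (u : Fin (d + 2) → Coord d) : Tens2 d :=
  barWedge g β y u + sym12 (extCovD g (omega g v β) y u)

/-- `β̃^♯ ∘ g`, where `β̃` is `(φ_w²)⁻¹` applied to the form part of `β`: a contravariant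
`4`-tensor whose third index is the raised one. -/
def betaTildeSharp (g : MetricField d) (w : VolField d) (β : BField d) (y : Coord d) : Tens4 d :=
  fun k l t i => phi2Inv (w y) (fun u => betaSharp g β y u t i) k l

/-- `c^{23}_{12} [(∇^g)² {sym_14 (β̃^♯ ∘ g)}]`. -/
def contractedHessian (g : MetricField d) (w : VolField d) (β : BField d) (y : Coord d) :
    Tens2 d :=
  contr2312 (nablaSq4 g (fun z => sym14 (betaTildeSharp g w β z)) y)

/-- The covariant derivative `(∇_{∂_r} w)(u_1, …, u_n)` of an `n`-form. -/
def nablaVol (g : MetricField d) (w : VolField d) (y : Coord d) (r : Fin (d + 2))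
    (u : Fin (d + 2) → Coord d) : ℝ :=
  fderiv ℝ (fun z => w z u) y (pd r)
    - ∑ s, w y (Function.update u s
        (∑ a, (∑ m, christoffel g a r m y * u s m) • pd a))

/-! ### Global objects on a manifold and their coordinate expressions -/

section Global

variable {N : Type*} [TopologicalSpace N] [ChartedSpace (Coord d) N]

/-- A field of bilinear forms on `N`. -/
abbrev MetricOn (d : ℕ) (N : Type*) [TopologicalSpace N] [ChartedSpace (Coord d) N] : Type _ :=
  ∀ x : N, Bilin (TangentSpace (𝓡 (d + 2)) x)

/-- An `n`-form on `N`. -/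
abbrev VolOn (d : ℕ) (N : Type*) [TopologicalSpace N] [ChartedSpace (Coord d) N] : Type _ :=
  ∀ x : N, TangentSpace (𝓡 (d + 2)) x [⋀^Fin (d + 2)]→L[ℝ] ℝ

/-- An `End(TN)`-valued horizontal `(n - 2)`-form on the bundle of metrics. It is given at all
bilinear forms `h` on `T_x N`, but only its values at metrics of the chosen signature matter. -/
abbrev BFormOn (d : ℕ) (N : Type*) [TopologicalSpace N] [ChartedSpace (Coord d) N] : Type _ :=
  ∀ x : N, Bilin (TangentSpace (𝓡 (d + 2)) x) →
    TangentSpace (𝓡 (d + 2)) x [⋀^Fin d]→L[ℝ]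
      (TangentSpace (𝓡 (d + 2)) x →L[ℝ] TangentSpace (𝓡 (d + 2)) x)

/-- The smooth atlas. -/
abbrev charts (d : ℕ) (N : Type*) [TopologicalSpace N] [ChartedSpace (Coord d) N] :
    Set (OpenPartialHomeomorph N (Coord d)) :=
  IsManifold.maximalAtlas (𝓡 (d + 2)) ∞ N

/-- The coordinate frame at `y`: it sends `pd i` to the tangent vector `∂/∂x^i`. -/
def frame (e : OpenPartialHomeomorph N (Coord d)) (y : Coord d) :
    Coord d →L[ℝ] TangentSpace (𝓡 (d + 2)) (e.symm y) :=
  mfderiv (𝓡 (d + 2)) (𝓡 (d + 2)) e.symm y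

/-- The coordinate coframe: it sends a tangent vector to its components. -/
def coframe (e : OpenPartialHomeomorph N (Coord d)) (y : Coord d) :
    TangentSpace (𝓡 (d + 2)) (e.symm y) →L[ℝ] Coord d :=
  mfderiv (𝓡 (d + 2)) (𝓡 (d + 2)) e (e.symm y)

/-- Coordinate expression of a field of bilinear forms. -/
def metricIn (e : OpenPartialHomeomorph N (Coord d)) (g : MetricOn d N) : MetricField d :=
  fun y => pullBilin (g (e.symm y)) (frame e y)

/-- Coordinate expression of an `n`-form. -/
def volIn (e : OpenPartialHomeomorph N (Coord d)) (v : VolOn d N) : VolField d :=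
  fun y u => v (e.symm y) (fun s => frame e y (u s))

/-- Coordinate expression of an `End(TN)`-valued horizontal `(n - 2)`-form on the bundle of
metrics. -/
def bIn (e : OpenPartialHomeomorph N (Coord d)) (β : BFormOn d N) : BField d :=
  fun y h u => (coframe e y).comp
    ((β (e.symm y) (pullBilin h (coframe e y))
      (fun s => frame e y (u s))).comp (frame e y))

/-- `g` is a smooth pseudo-Riemannian metric of signature `(p, q)` on `N`. -/
structure IsPseudoMetric (p q : ℕ) (g : MetricOn d N) : Prop where
  isMetricForm : ∀ x, IsMetricForm p q (g x)
  smooth : ∀ e ∈ charts d N, ∀ X Y : Coord d,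
    ContDiffOn ℝ ∞ (fun y => metricIn e g y X Y) e.target

/-- `v` is a smooth volume form (a nowhere vanishing `n`-form) on `N`. -/
structure IsVolumeForm (v : VolOn d N) : Prop where
  ne_zero : ∀ x, v x ≠ 0
  smooth : ∀ e ∈ charts d N, ∀ u : Fin (d + 2) → Coord d,
    ContDiffOn ℝ ∞ (fun y => volIn e v y u) e.target

/-- `β` is a smooth `𝒜(TN)`-valued horizontal `(n - 2)`-form on the bundle of metrics of signature
`(p, q)`: its values at a metric `h` are endomorphisms that are skew-symmetric for `h`. -/
structure IsAdjointForm (p q : ℕ) (β : BFormOn d N) : Prop where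
  skew : ∀ (x : N) (h : Bilin (TangentSpace (𝓡 (d + 2)) x)), IsMetricForm p q h →
    ∀ (u : Fin d → TangentSpace (𝓡 (d + 2)) x) (X Y : TangentSpace (𝓡 (d + 2)) x),
      h (β x h u X) Y + h X (β x h u Y) = 0
  smooth : ∀ e ∈ charts d N, ∀ (u : Fin d → Coord d) (X : Coord d),
    ContDiffOn ℝ ∞ (fun z : Coord d × Bilin (Coord d) => bIn e β z.1 z.2 u X)
      (e.target ×ˢ {h | IsMetricForm p q h})

/-- The metric `g` is flat: its curvature tensor vanishes. -/
def IsFlat (g : MetricOn d N) : Prop :=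
  ∀ e ∈ charts d N, ∀ y ∈ e.target, ∀ i j k l, curvature (metricIn e g) i j k l y = 0

/-- The `n`-form `w` is parallel: `∇^g w = 0`. -/
def IsParallelVol (g : MetricOn d N) (w : VolOn d N) : Prop :=
  ∀ e ∈ charts d N, ∀ y ∈ e.target, ∀ r u, nablaVol (metricIn e g) (volIn e w) y r u = 0

/-- The metric `g` solves the Euler–Lagrange equations
`g^*(d_{M/N} β) ⊼ R^g + sym_12 ∘ d^∇ (ω_{n-1}(g, β)) = 0`, an equation of `(TN ⊗ TN)`-valued
`n`-forms on `N`. -/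
def SolvesEulerLagrange (g : MetricOn d N) (v : VolOn d N) (β : BFormOn d N) : Prop :=
  ∀ e ∈ charts d N, ∀ y ∈ e.target, ∀ u : Fin (d + 2) → Coord d,
    eulerLagrange (metricIn e g) (volIn e v) (bIn e β) y u = 0

/-- The equation `c^{23}_{12} [(∇^g)² {sym_14 (β̃^♯ ∘ g)}] = 0` on `N`, where `β̃` is formed with
the volume form `w`. -/
def SolvesContractedHessian (g : MetricOn d N) (w : VolOn d N) (β : BFormOn d N) : Prop :=
  ∀ e ∈ charts d N, ∀ y ∈ e.target,
    contractedHessian (metricIn e g) (volIn e w) (bIn e β) y = 0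

end Global

end BFTheory

end

noncomputable section

namespace BFTheory

variable {d : ℕ}

/-! ### Components of forms -/

/-! Flatness removes the curvature term, so only `sym12` of d^∇ω remains. The operator (φ_v¹)⁻¹ ⊗
φ_v¹ is unchanged when v is multiplied by a function, so v may be replaced by the parallel form w
(`phi1Inv_mul_phi1`). Contraction with a parallel volume form turns exterior covariant derivatives
into divergences.

Write B for β̃^♯ ∘ g. Then (φ_w¹)⁻¹ applied to d^∇(g^*β)^♯ has components F^{lab} = ∇_k B^{klab}
(`phi1Inv_extCovD`), and d^∇ of F^{lab} i_{∂_b}w is w ∇_b F^{lab} (`extCovD_phi1`). Since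
contraction commutes with ∇, d^∇ω = w ∇_b∇_k B^{klab} (`sum_nablaSq4_eq_divergence`).

B is skew in its first pair of indices as a bivector and in its last pair because β is skew for g;
hence B^{klab} = B^{lkba}. Flatness makes the second covariant derivatives commute
(`nablaSq4_comm`), which puts the indices in the order of the contraction c^{23}_{12}. As `sym14`
commutes with ∇² (`nablaSq4_sym14`), symmetrizing gives, in every chart, EL = w ⊗ (contracted
Hessian) (`eulerLagrange_eq_mul_contractedHessian`). Since w vanishes nowhere, the two equations are
equivalent. -/

theorem pd_apply (i j : Fin (d + 2)) : (pd i : Coord d) j = if j = i then 1 else 0 := by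
  simp [pd]

theorem sum_smul_pd (X : Coord d) : ∑ i, X i • pd i = X := by
  ext j
  simp [pd_apply]

theorem phi2Inv_swap (v : (Fin (d + 2) → Coord d) → ℝ) (η : (Fin d → Coord d) → ℝ)
    (a b : Fin (d + 2)) : phi2Inv v η a b = -phi2Inv v η b a := by
  unfold phi2Inv
  rw [← Finset.sum_neg_distrib]
  refine Finset.sum_congr rfl fun l _ => ?_
  rw [← Finset.sum_neg_distrib]
  refine Finset.sum_congr rfl fun k _ => ?_
  simp only [and_comm (a := b = _)]
  split_ifs <;> ring

theorem phi2Inv_castSucc_of_lt (v : (Fin (d + 2) → Coord d) → ℝ) (η : (Fin d → Coord d) → ℝ)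
    {k : Fin (d + 1)} {l : Fin (d + 2)} (h : k.castSucc < l) :
    phi2Inv v η k.castSucc l = (-1) ^ ((k : ℕ) + (l : ℕ)) * η (omitTwo pd l k) / v pd := by
  unfold phi2Inv
  -- The sum runs over increasing pairs only, so the reversed Kronecker term never fires for an
  -- increasing pair of indices.
  have key : ∀ l' : Fin (d + 2), ∀ k' : Fin (d + 1), k'.castSucc < l' →
      ¬ (k.castSucc = l' ∧ l = k'.castSucc) := by
    rintro l' k' h' ⟨rfl, rfl⟩
    exact absurd h (not_lt.2 h'.le)
  rw [Finset.sum_eq_single l, Finset.sum_eq_single k]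
  · rw [if_pos h, if_pos ⟨rfl, rfl⟩, if_neg (key l k h)]
    ring
  · intro k' _ hk'
    split_ifs with h1 h2 h3 h3
    · exact absurd (Fin.castSucc_injective _ h2.1) (Ne.symm hk')
    · exact absurd (Fin.castSucc_injective _ h2.1) (Ne.symm hk')
    · exact absurd h3 (key l k' h1)
    · simp
    · rfl
  · simp
  · intro l' _ hl'
    refine Finset.sum_eq_zero fun k' _ => ?_
    split_ifs with h1 h2 h3 h3
    · exact absurd h2.2 (Ne.symm hl')
    · exact absurd h2.2 (Ne.symm hl')
    · exact absurd h3 (key l' k' h1)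
    · simp
    · rfl
  · simp

/-- One sign formula serves both orders of the two indices: once `l.succAbove s` passes `l`, its
value is `s + 1`, and this extra sign is the one produced by antisymmetry. -/
theorem phi2Inv_succAbove (v : (Fin (d + 2) → Coord d) → ℝ) (η : (Fin d → Coord d) → ℝ)
    (l : Fin (d + 2)) (s : Fin (d + 1)) :
    phi2Inv v η (l.succAbove s) l =
      (-1) ^ ((s : ℕ) + (l : ℕ)) * η (omitTwo pd l s) / v pd := by
  rcases lt_or_ge s.castSucc l with h | h
  · rw [Fin.succAbove_of_castSucc_lt _ _ h, phi2Inv_castSucc_of_lt v η h]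
  · rw [Fin.succAbove_of_le_castSucc _ _ h, phi2Inv_swap]
    have hl : l ≠ Fin.last _ := fun hl => by
      subst hl; exact absurd h (not_le.2 (Fin.castSucc_lt_last s))
    obtain ⟨l', rfl⟩ := Fin.exists_castSucc_eq.2 hl
    have h' : l' ≤ s := by simpa using h
    rw [phi2Inv_castSucc_of_lt v η (Fin.castSucc_lt_succ_iff.2 h')]
    have e : omitTwo (pd : Fin (d + 2) → Coord d) s.succ l' = omitTwo pd l'.castSucc s := by
      funext t
      unfold omitTwo
      congr 1
      have h1 := Fin.succAbove_succAbove_succAbove_predAbove l'.castSucc s t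
      rw [Fin.succAbove_of_le_castSucc _ _ h,
        Fin.predAbove_of_le_castSucc _ _ h, Fin.castPred_castSucc] at h1
      exact h1
    rw [e]
    simp only [Fin.val_succ, Fin.val_castSucc]
    ring

/-- Cramer's rule for a top form: `ℓ ∧ w = 0`. -/
theorem sum_mul_cons_removeNth {w : Coord d [⋀^Fin (d + 2)]→ₗ[ℝ] ℝ} (ℓ : Coord d →ₗ[ℝ] ℝ)
    (x : Coord d) (u : Fin (d + 2) → Coord d) :
    ∑ s : Fin (d + 2), (-1) ^ (s : ℕ) * (ℓ (u s) * w (Fin.cons x (s.removeNth u))) = ℓ x * w u := by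
  have h0 : AlternatingMap.alternatizeUncurryFin (ℓ.smulRight w)
      (Fin.cons x u : Fin (d + 3) → Coord d) = 0 := by
    -- The d + 3 vectors x, u_0, …, u_{d+1} lie in a space of dimension d + 2.
    apply AlternatingMap.map_linearDependent
    intro h
    have := h.fintype_card_le_finrank
    simp at this
  rw [AlternatingMap.alternatizeUncurryFin_apply, Fin.sum_univ_succ] at h0
  have h1 : ∀ s : Fin (d + 2), s.succ.removeNth (Fin.cons x u : Fin (d + 3) → Coord d) =
      Fin.cons x (s.removeNth u) := by
    intro s
    funext j
    refine Fin.cases ?_ (fun j => ?_) j <;> simp [Fin.removeNth]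
  simp only [Fin.cons_zero, Fin.cons_succ, h1] at h0
  simp [pow_succ, smul_eq_mul] at h0
  linarith

/-- Top forms are determined by their value on the coordinate frame. -/
theorem map_eq_mul_det (w : Coord d [⋀^Fin (d + 2)]→ₗ[ℝ] ℝ) (u : Fin (d + 2) → Coord d) :
    w u = w pd * (EuclideanSpace.basisFun (Fin (d + 2)) ℝ).toBasis.det u := by
  have h := congrArg (fun f => f u)
    (w.eq_smul_basis_det (EuclideanSpace.basisFun (Fin (d + 2)) ℝ).toBasis)
  have e : ((EuclideanSpace.basisFun (Fin (d + 2)) ℝ).toBasis : Fin (d + 2) → Coord d) = pd := by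
    funext i
    simp [pd]
  rw [e] at h
  simpa using h

/-! ### Partial derivatives -/

section PartialDerivatives

variable {U : Set (Coord d)} {f h : Coord d → ℝ} {y : Coord d}

theorem differentiableAt_of_contDiffOn (hU : IsOpen U) (hf : ContDiffOn ℝ ∞ f U) (hy : y ∈ U) :
    DifferentiableAt ℝ f y :=
  (hf.contDiffAt (hU.mem_nhds hy)).differentiableAt (by simp)

theorem contDiffOn_partialD (hU : IsOpen U) (hf : ContDiffOn ℝ ∞ f U) (i : Fin (d + 2)) :
    ContDiffOn ℝ ∞ (partialD i f) U :=
  (hf.fderiv_of_isOpen hU (by simp)).clm_apply contDiffOn_const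

theorem partialD_congr (hU : IsOpen U) (hfh : Set.EqOn f h U) (hy : y ∈ U) (i : Fin (d + 2)) :
    partialD i f y = partialD i h y := by
  unfold partialD
  rw [Filter.EventuallyEq.fderiv_eq (hfh.eventuallyEq_of_mem (hU.mem_nhds hy))]

theorem partialD_add (hf : DifferentiableAt ℝ f y) (hh : DifferentiableAt ℝ h y)
    (i : Fin (d + 2)) :
    partialD i (fun z => f z + h z) y = partialD i f y + partialD i h y := by
  simp [partialD, fderiv_fun_add hf hh]

theorem partialD_mul (hf : DifferentiableAt ℝ f y) (hh : DifferentiableAt ℝ h y)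
    (i : Fin (d + 2)) :
    partialD i (fun z => f z * h z) y = partialD i f y * h y + f y * partialD i h y := by
  simp [partialD, fderiv_fun_mul hf hh]
  ring

theorem partialD_const_mul (hf : DifferentiableAt ℝ f y) (c : ℝ) (i : Fin (d + 2)) :
    partialD i (fun z => c * f z) y = c * partialD i f y := by
  simp [partialD, fderiv_const_mul hf]

theorem partialD_sum {ι : Type*} [Fintype ι] {F : ι → Coord d → ℝ}
    (hF : ∀ m, DifferentiableAt ℝ (F m) y) (i : Fin (d + 2)) :
    partialD i (fun z => ∑ m, F m z) y = ∑ m, partialD i (F m) y := by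
  simp [partialD, fderiv_fun_sum fun m _ => hF m]

theorem partialD_comm (hU : IsOpen U) (hf : ContDiffOn ℝ ∞ f U) (hy : y ∈ U)
    (i j : Fin (d + 2)) : partialD i (partialD j f) y = partialD j (partialD i f) y := by
  have h2 : DifferentiableAt ℝ (fderiv ℝ f) y :=
    ((hf.fderiv_of_isOpen hU (m := ∞) (by simp)).contDiffAt (hU.mem_nhds hy)).differentiableAt
      (by simp)
  have hs : IsSymmSndFDerivAt ℝ f y :=
    (hf.contDiffAt (hU.mem_nhds hy)).isSymmSndFDerivAt (by
      simpa using (WithTop.coe_le_coe.2 (le_top : (2 : ℕ∞) ≤ ⊤) : ((2 : ℕ∞) : WithTop ℕ∞) ≤ ∞))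
  have key : ∀ a b : Fin (d + 2), partialD a (partialD b f) y =
      fderiv ℝ (fderiv ℝ f) y (pd a) (pd b) := by
    intro a b
    change fderiv ℝ (fun z => fderiv ℝ f z (pd b)) y (pd a) = _
    rw [fderiv_clm_apply h2 (by fun_prop)]
    simp
  rw [key, key]
  exact hs _ _

theorem fderiv_eq_sum_partialD (f : Coord d → ℝ) (y X : Coord d) :
    fderiv ℝ f y X = ∑ i, X i * partialD i f y := by
  conv_lhs => rw [← sum_smul_pd X]
  simp [partialD]

end PartialDerivatives

/-! ### Smoothness of the Christoffel symbols -/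

section Christoffel

variable {U : Set (Coord d)} {g : MetricField d}

/-- A kernel vector of the Gram matrix holds the components of a vector orthogonal to everything. -/
theorem det_lower_ne_zero {y : Coord d} (hnd : ∀ X, (∀ Y, g y X Y = 0) → X = 0)
    (hsymm : ∀ X Y, g y X Y = g y Y X) :
    (Matrix.of fun a b => lower g a b y).det ≠ 0 := by
  intro h
  obtain ⟨x, hx0, hx⟩ := Matrix.exists_mulVec_eq_zero_iff.2 h
  apply hx0
  have h1 : (∑ i, x i • pd i : Coord d) = 0 := by
    apply hnd
    intro Y
    have hx' : ∀ j, g y (pd j) (∑ i, x i • pd i) = 0 := by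
      intro j
      have := congrFun hx j
      simp only [Matrix.mulVec, dotProduct, Matrix.of_apply, Pi.zero_apply, lower] at this
      simpa [mul_comm] using this
    generalize (∑ i, x i • pd i : Coord d) = X at hx' ⊢
    rw [hsymm, ← sum_smul_pd Y]
    simp [hx']
  funext j
  have := congrArg (fun X : Coord d => X j) h1
  simpa [pd_apply] using this

theorem contDiffOn_det {ι : Type*} [Fintype ι] [DecidableEq ι] {A : Coord d → Matrix ι ι ℝ}
    (hA : ∀ i j, ContDiffOn ℝ ∞ (fun y => A y i j) U) :
    ContDiffOn ℝ ∞ (fun y => (A y).det) U := by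
  simp only [Matrix.det_apply']
  exact ContDiffOn.sum fun σ _ => contDiffOn_const.mul (contDiffOn_prod fun i _ => hA _ _)

theorem contDiffOn_lower (hs : ∀ X Y, ContDiffOn ℝ ∞ (fun y => g y X Y) U)
    (i j : Fin (d + 2)) : ContDiffOn ℝ ∞ (lower g i j) U := hs _ _

theorem contDiffOn_upper (hs : ∀ X Y, ContDiffOn ℝ ∞ (fun y => g y X Y) U)
    (hdet : ∀ y ∈ U, (Matrix.of fun a b => lower g a b y).det ≠ 0)
    (i j : Fin (d + 2)) : ContDiffOn ℝ ∞ (upper g i j) U := by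
  -- Cramer's formula expresses the inverse through determinants, which are polynomial in the g_ij.
  have h : upper g i j = fun y => ((Matrix.of fun a b => lower g a b y).det)⁻¹ *
      ((Matrix.of fun a b => lower g a b y).updateRow j (Pi.single i 1)).det := by
    funext y
    simp [upper, Matrix.inv_def, Matrix.adjugate_apply]
  rw [h]
  refine (ContDiffOn.inv (contDiffOn_det fun a b => hs _ _) hdet).mul (contDiffOn_det fun a b => ?_)
  by_cases hb : a = j
  · subst hb
    simpa using contDiffOn_const
  · simpa [Matrix.updateRow_ne hb] using contDiffOn_lower hs _ _

theorem contDiffOn_christoffel (hU : IsOpen U) (hs : ∀ X Y, ContDiffOn ℝ ∞ (fun y => g y X Y) U)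
    (hdet : ∀ y ∈ U, (Matrix.of fun a b => lower g a b y).det ≠ 0) (k i j : Fin (d + 2)) :
    ContDiffOn ℝ ∞ (christoffel g k i j) U := by
  unfold christoffel
  refine contDiffOn_const.mul (ContDiffOn.sum fun l _ => (contDiffOn_upper hs hdet _ _).mul ?_)
  exact ((contDiffOn_partialD hU (hs _ _) _).add (contDiffOn_partialD hU (hs _ _) _)).sub
    (contDiffOn_partialD hU (hs _ _) _)

theorem christoffel_symm (hU : IsOpen U) (hsymm : ∀ y ∈ U, ∀ X Y, g y X Y = g y Y X)
    {y : Coord d} (hy : y ∈ U) (k i j : Fin (d + 2)) :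
    christoffel g k i j y = christoffel g k j i y := by
  unfold christoffel
  congr 1
  refine Finset.sum_congr rfl fun l _ => ?_
  rw [partialD_congr hU (f := lower g i j) (h := lower g j i) (fun z hz => hsymm z hz _ _) hy]
  ring

end Christoffel

/-! ### Covariant derivatives of `4`-tensors -/

section Nabla

variable {U : Set (Coord d)} {g : MetricField d} {B C : Coord d → Tens4 d} {y : Coord d}

theorem nabla4_congr (hU : IsOpen U) (h : Set.EqOn B C U) (hy : y ∈ U) (r : Fin (d + 2)) :
    nabla4 g B y r = nabla4 g C y r := by
  funext a b c e
  unfold nabla4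
  rw [h hy, partialD_congr hU (h := fun z => C z a b c e) (fun z hz => by simp only [h hz]) hy]

theorem nablaSq4_congr (hU : IsOpen U) (h : Set.EqOn B C U) (hy : y ∈ U) (r s : Fin (d + 2)) :
    nablaSq4 g B y r s = nablaSq4 g C y r s := by
  funext a b c e
  unfold nablaSq4
  rw [nabla4_congr hU (fun z hz => nabla4_congr hU h hz s) hy]
  simp only [nabla4_congr hU h hy]

/-- Covariant derivatives commute with the exchange of the first and the last two indices. -/
theorem nabla4_swap (r a b c e : Fin (d + 2)) :
    nabla4 g (fun z a b c e => B z b a e c) y r a b c e = nabla4 g B y r b a e c := by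
  unfold nabla4
  congr 1
  exact Finset.sum_congr rfl fun m _ => by ring

theorem nablaSq4_swap (r s a b c e : Fin (d + 2)) :
    nablaSq4 g (fun z a b c e => B z b a e c) y r s a b c e = nablaSq4 g B y r s b a e c := by
  unfold nablaSq4
  have : (fun z => nabla4 g (fun z a b c e => B z b a e c) z s) =
      fun z a b c e => nabla4 g B z s b a e c := by
    funext z a b c e
    exact nabla4_swap s a b c e
  rw [this, nabla4_swap (B := fun z => nabla4 g B z s)]
  congr 1
  exact Finset.sum_congr rfl fun m _ => by rw [nabla4_swap]

theorem nabla4_sym14 (hB : ∀ a b c e, DifferentiableAt ℝ (fun z => B z a b c e) y)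
    (r a b c e : Fin (d + 2)) :
    nabla4 g (fun z => sym14 (B z)) y r a b c e = sym14 (nabla4 g B y r) a b c e := by
  unfold nabla4 sym14
  rw [partialD_add (hB _ _ _ _) (hB _ _ _ _), add_add_add_comm, ← Finset.sum_add_distrib]
  congr 1
  exact Finset.sum_congr rfl fun m _ => by ring

theorem contDiffOn_nabla4 (hU : IsOpen U)
    (hΓ : ∀ k i j, ContDiffOn ℝ ∞ (christoffel g k i j) U)
    (hB : ∀ a b c e, ContDiffOn ℝ ∞ (fun z => B z a b c e) U) (r a b c e : Fin (d + 2)) :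
    ContDiffOn ℝ ∞ (fun z => nabla4 g B z r a b c e) U := by
  unfold nabla4
  refine (contDiffOn_partialD hU (hB _ _ _ _) _).add (ContDiffOn.sum fun m _ => ?_)
  exact ((((hΓ _ _ _).mul (hB _ _ _ _)).add ((hΓ _ _ _).mul (hB _ _ _ _))).add
    ((hΓ _ _ _).mul (hB _ _ _ _))).add ((hΓ _ _ _).mul (hB _ _ _ _))

theorem nablaSq4_sym14 (hU : IsOpen U)
    (hΓ : ∀ k i j, ContDiffOn ℝ ∞ (christoffel g k i j) U)
    (hB : ∀ a b c e, ContDiffOn ℝ ∞ (fun z => B z a b c e) U) (hy : y ∈ U)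
    (r s a b c e : Fin (d + 2)) :
    nablaSq4 g (fun z => sym14 (B z)) y r s a b c e = sym14 (nablaSq4 g B y r s) a b c e := by
  have h1 : ∀ z ∈ U, ∀ s, nabla4 g (fun z => sym14 (B z)) z s = sym14 (nabla4 g B z s) := by
    intro z hz s
    funext a b c e
    exact nabla4_sym14 (fun a b c e => differentiableAt_of_contDiffOn hU (hB a b c e) hz) s a b c e
  unfold nablaSq4
  rw [nabla4_congr hU (C := fun z => sym14 (nabla4 g B z s)) (fun z hz => h1 z hz s) hy,
    nabla4_sym14 (fun a b c e =>
      differentiableAt_of_contDiffOn hU (contDiffOn_nabla4 hU hΓ hB s a b c e) hy)]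
  simp only [h1 y hy, sym14, mul_add, Finset.sum_add_distrib]
  ring

/-- The Ricci identity for one index: the curvature acts on it. -/
theorem sum_curvature_mul (hU : IsOpen U)
    (hsymm : ∀ z ∈ U, ∀ k i j, christoffel g k i j z = christoffel g k j i z) (hy : y ∈ U)
    (hflat : ∀ i j k l, curvature g i j k l y = 0)
    (r s a : Fin (d + 2)) (T : Fin (d + 2) → ℝ) :
    ∑ m, partialD r (christoffel g a s m) y * T m
        + ∑ m, ∑ p, christoffel g a r m y * christoffel g m s p y * T p =
      ∑ m, partialD s (christoffel g a r m) y * T m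
        + ∑ m, ∑ p, christoffel g a s m y * christoffel g m r p y * T p := by
  have h : ∀ j, partialD r (christoffel g a s j) y + ∑ m, christoffel g a r m y * christoffel g m s j y
      = partialD s (christoffel g a r j) y
        + ∑ m, christoffel g a s m y * christoffel g m r j y := by
    intro j
    have := hflat a j r s
    unfold curvature at this
    -- `curvature` has the differentiating index as the last index of Γ, whereas `nabla4` has it in
    -- the middle; vanishing torsion converts one into the other.
    rw [Finset.sum_sub_distrib, partialD_congr hU (fun z hz => hsymm z hz a j s) hy,
      partialD_congr hU (fun z hz => hsymm z hz a j r) hy] at this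
    simp only [hsymm y hy _ j] at this
    simp only [mul_comm (christoffel g a _ _ y)]
    linarith
  rw [Finset.sum_comm (γ := Fin (d + 2)) (f := fun m p => christoffel g a r m y * christoffel g m s p y * T p),
    Finset.sum_comm (γ := Fin (d + 2)) (f := fun m p => christoffel g a s m y * christoffel g m r p y * T p)]
  simp only [← Finset.sum_mul, ← Finset.sum_add_distrib, ← add_mul, h]

/-- Covariant derivatives along coordinate fields commute for a flat metric. -/
theorem nabla4_nabla4_comm (hU : IsOpen U)
    (hΓ : ∀ k i j, ContDiffOn ℝ ∞ (christoffel g k i j) U)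
    (hB : ∀ a b c e, ContDiffOn ℝ ∞ (fun z => B z a b c e) U) (hy : y ∈ U)
    (hsymm : ∀ z ∈ U, ∀ k i j, christoffel g k i j z = christoffel g k j i z)
    (hflat : ∀ i j k l, curvature g i j k l y = 0) (r s a b c e : Fin (d + 2)) :
    nabla4 g (fun z => nabla4 g B z s) y r a b c e =
      nabla4 g (fun z => nabla4 g B z r) y s a b c e := by
  have dΓ := fun k i j => differentiableAt_of_contDiffOn hU (hΓ k i j) hy
  have dB := fun a b c e => differentiableAt_of_contDiffOn hU (hB a b c e) hy
  have dP := fun i a b c e =>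
    differentiableAt_of_contDiffOn hU (contDiffOn_partialD hU (hB a b c e) i) hy
  have dM : ∀ k i j a b c e, DifferentiableAt ℝ (fun z => christoffel g k i j z * B z a b c e) y :=
    fun k i j a b c e => (dΓ k i j).mul (dB a b c e)
  have e1 : ∀ r s, partialD r (fun z => nabla4 g B z s a b c e) y =
      partialD r (partialD s fun z => B z a b c e) y +
      ∑ m, (partialD r (christoffel g a s m) y * B y m b c e
          + christoffel g a s m y * partialD r (fun z => B z m b c e) y
        + (partialD r (christoffel g b s m) y * B y a m c e
          + christoffel g b s m y * partialD r (fun z => B z a m c e) y)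
        + (partialD r (christoffel g c s m) y * B y a b m e
          + christoffel g c s m y * partialD r (fun z => B z a b m e) y)
        + (partialD r (christoffel g e s m) y * B y a b c m
          + christoffel g e s m y * partialD r (fun z => B z a b c m) y)) := by
    intro r s
    unfold nabla4
    rw [partialD_add (dP s a b c e) (DifferentiableAt.fun_sum fun m _ =>
      (((dM _ _ _ _ _ _ _).fun_add (dM _ _ _ _ _ _ _)).fun_add (dM _ _ _ _ _ _ _)).fun_add
        (dM _ _ _ _ _ _ _)),
      partialD_sum fun m => (((dM _ _ _ _ _ _ _).fun_add (dM _ _ _ _ _ _ _)).fun_add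
        (dM _ _ _ _ _ _ _)).fun_add (dM _ _ _ _ _ _ _)]
    congr 1
    refine Finset.sum_congr rfl fun m _ => ?_
    rw [partialD_add (((dM _ _ _ _ _ _ _).fun_add (dM _ _ _ _ _ _ _)).fun_add (dM _ _ _ _ _ _ _))
      (dM _ _ _ _ _ _ _), partialD_add ((dM _ _ _ _ _ _ _).fun_add (dM _ _ _ _ _ _ _))
      (dM _ _ _ _ _ _ _), partialD_add (dM _ _ _ _ _ _ _) (dM _ _ _ _ _ _ _),
      partialD_mul (dΓ _ _ _) (dB _ _ _ _), partialD_mul (dΓ _ _ _) (dB _ _ _ _),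
      partialD_mul (dΓ _ _ _) (dB _ _ _ _), partialD_mul (dΓ _ _ _) (dB _ _ _ _)]
  have e2 : ∀ r s, nabla4 g (fun z => nabla4 g B z s) y r a b c e =
      partialD r (fun z => nabla4 g B z s a b c e) y +
    ∑ m, (christoffel g a r m y * nabla4 g B y s m b c e
        + christoffel g b r m y * nabla4 g B y s a m c e
        + christoffel g c r m y * nabla4 g B y s a b m e
        + christoffel g e r m y * nabla4 g B y s a b c m) := fun _ _ => rfl
  -- Terms in which both connections act on the same slot: their antisymmetrization in r, s is the
  -- curvature on that slot, one identity per slot.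
  have c1 := sum_curvature_mul hU hsymm hy hflat r s a fun m => B y m b c e
  have c2 := sum_curvature_mul hU hsymm hy hflat r s b fun m => B y a m c e
  have c3 := sum_curvature_mul hU hsymm hy hflat r s c fun m => B y a b m e
  have c4 := sum_curvature_mul hU hsymm hy hflat r s e fun m => B y a b c m
  -- Terms in which the connections act on two different slots: exchanging r and s permutes them, so
  -- they cancel for any connection.
  have cross : ∀ (i j : Fin (d + 2)) (T : Fin (d + 2) → Fin (d + 2) → ℝ),
      ∑ m, ∑ p, christoffel g i r m y * (christoffel g j s p y * T m p) =
        ∑ p, ∑ m, christoffel g j s p y * (christoffel g i r m y * T m p) := by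
    intro i j T
    rw [Finset.sum_comm]
    exact Finset.sum_congr rfl fun _ _ => Finset.sum_congr rfl fun _ _ => by ring
  have x1 := cross a b fun m p => B y m p c e
  have x2 := cross a c fun m p => B y m b p e
  have x3 := cross a e fun m p => B y m b c p
  have x4 := cross b a fun m p => B y p m c e
  have x5 := cross b c fun m p => B y a m p e
  have x6 := cross b e fun m p => B y a m c p
  have x7 := cross c a fun m p => B y p b m e
  have x8 := cross c b fun m p => B y a p m e
  have x9 := cross c e fun m p => B y a b m p
  have x10 := cross e a fun m p => B y p b c m
  have x11 := cross e b fun m p => B y a p c m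
  have x12 := cross e c fun m p => B y a b p m
  have hp := partialD_comm hU (hB a b c e) hy r s
  rw [e2, e2, e1, e1]
  unfold nabla4
  simp only [mul_add, Finset.mul_sum, Finset.sum_add_distrib, mul_assoc] at c1 c2 c3 c4 ⊢
  linarith

/-- The correction Γ^m_{rs} ∇_m is symmetric in r, s for lack of torsion, so only the commutation
along coordinate fields is needed. -/
theorem nablaSq4_comm (hU : IsOpen U)
    (hΓ : ∀ k i j, ContDiffOn ℝ ∞ (christoffel g k i j) U)
    (hB : ∀ a b c e, ContDiffOn ℝ ∞ (fun z => B z a b c e) U) (hy : y ∈ U)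
    (hsymm : ∀ z ∈ U, ∀ k i j, christoffel g k i j z = christoffel g k j i z)
    (hflat : ∀ i j k l, curvature g i j k l y = 0) (r s a b c e : Fin (d + 2)) :
    nablaSq4 g B y r s a b c e = nablaSq4 g B y s r a b c e := by
  unfold nablaSq4
  rw [nabla4_nabla4_comm hU hΓ hB hy hsymm hflat r s]
  simp only [hsymm y hy _ r s]

end Nabla

/-! ### Exterior covariant derivatives as divergences -/

section Divergence

variable {U : Set (Coord d)} {g : MetricField d} {w : VolField d} {y : Coord d}

/-- The trace `Γ^m_{im}` of the connection. -/
def traceGamma (g : MetricField d) (y : Coord d) (i : Fin (d + 2)) : ℝ :=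
  ∑ m, christoffel g m i m y

/-- Replacing ∂_s by another coordinate vector repeats an argument of the alternating form, so only
the trace of the connection matrix survives. -/
theorem nablaVol_pd {W : Coord d [⋀^Fin (d + 2)]→ₗ[ℝ] ℝ} (hW : ∀ u, w y u = W u)
    (r : Fin (d + 2)) :
    nablaVol g w y r pd = partialD r (fun z => w z pd) y - traceGamma g y r * w y pd := by
  unfold nablaVol traceGamma partialD
  congr 1
  rw [Finset.sum_mul]
  refine Finset.sum_congr rfl fun s _ => ?_
  have h1 : ∀ a, W (Function.update pd s (pd a)) = if a = s then W pd else 0 := by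
    intro a
    split_ifs with h
    · rw [h, Function.update_eq_self]
    · exact W.map_eq_zero_of_eq _ (i := s) (j := a)
        (by rw [Function.update_self, Function.update_of_ne h]) (Ne.symm h)
  rw [hW, hW, AlternatingMap.map_update_sum]
  simp [AlternatingMap.map_update_smul, h1, pd_apply]

/-- A parallel volume form satisfies `∂_r w = Γ^m_{rm} w`. -/
theorem partialD_vol (hU : IsOpen U)
    (hw : ∀ z ∈ U, ∃ W : Coord d [⋀^Fin (d + 2)]→ₗ[ℝ] ℝ, ∀ u, w z u = W u)
    (hws : ∀ u, ContDiffOn ℝ ∞ (fun z => w z u) U) (hy : y ∈ U)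
    (hwpar : ∀ r, nablaVol g w y r pd = 0) (r : Fin (d + 2)) (u : Fin (d + 2) → Coord d) :
    partialD r (fun z => w z u) y = traceGamma g y r * w y u := by
  have hdet : ∀ z ∈ U, w z u = (EuclideanSpace.basisFun (Fin (d + 2)) ℝ).toBasis.det u * w z pd := by
    intro z hz
    obtain ⟨W, hW⟩ := hw z hz
    rw [hW, hW, map_eq_mul_det, mul_comm]
  obtain ⟨W, hW⟩ := hw y hy
  have h := hwpar r
  rw [nablaVol_pd hW, sub_eq_zero] at h
  rw [partialD_congr hU hdet hy,
    partialD_const_mul (differentiableAt_of_contDiffOn hU (hws pd) hy), h, hdet y hy]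
  ring

/-- In the divergence of B, Γ on the first slot contracts to its trace, which is the logarithmic
derivative of w; Γ on the second slot vanishes, being symmetric against an antisymmetric pair; Γ on
the last two slots is what d^∇ contains. -/
theorem phi1Inv_extCovD (hU : IsOpen U)
    (hsymm : ∀ k i j, christoffel g k i j y = christoffel g k j i y)
    (hws : ∀ u, ContDiffOn ℝ ∞ (fun z => w z u) U) (hw0 : ∀ z ∈ U, w z pd ≠ 0) (hy : y ∈ U)
    (hwpar : ∀ r, partialD r (fun z => w z pd) y = traceGamma g y r * w y pd)
    (η : Coord d → (Fin d → Coord d) → Tens2 d) {B : Coord d → Tens4 d}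
    (hB : ∀ z k l a b, B z k l a b = phi2Inv (w z) (fun u => η z u a b) k l)
    (hBs : ∀ a b c e, ContDiffOn ℝ ∞ (fun z => B z a b c e) U) (l a b : Fin (d + 2)) :
    phi1Inv (w y) (fun u => extCovD g η y u a b) l = ∑ k, nabla4 g B y k k l a b := by
  have hanti : ∀ z k l a b, B z k l a b = -B z l k a b := by
    intro z k l a b
    rw [hB, hB, phi2Inv_swap]
  have h0 : ∀ z l a b, B z l l a b = 0 := fun z l a b => by linarith [hanti z l l a b]
  have hη : ∀ z ∈ U, ∀ (s : Fin (d + 1)) a b, η z (omitTwo pd l s) a b =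
      (-1) ^ ((s : ℕ) + (l : ℕ)) * (w z pd * B z (l.succAbove s) l a b) := by
    intro z hz s a b
    rw [hB, phi2Inv_succAbove]
    rw [mul_div_cancel₀ _ (hw0 z hz), ← mul_assoc, ← mul_pow]
    simp
  have hdiv : ∑ k, nabla4 g B y k k l a b =
      ∑ k, (partialD k (fun z => B z k l a b) y + traceGamma g y k * B y k l a b
        + ∑ m, christoffel g a k m y * B y k l m b
        + ∑ m, christoffel g b k m y * B y k l a m) := by
    have t1 : ∑ k, ∑ m, christoffel g k k m y * B y m l a b =
        ∑ k, traceGamma g y k * B y k l a b := by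
      rw [Finset.sum_comm]
      refine Finset.sum_congr rfl fun m _ => ?_
      rw [← Finset.sum_mul]
      congr 1
      exact Finset.sum_congr rfl fun k _ => hsymm _ _ _
    have t2 : ∑ k, ∑ m, christoffel g l k m y * B y k m a b = 0 := by
      have h1 : ∑ k, ∑ m, christoffel g l k m y * B y k m a b =
          -∑ k, ∑ m, christoffel g l k m y * B y k m a b := by
        conv_lhs => rw [Finset.sum_comm]
        rw [← Finset.sum_neg_distrib]
        refine Finset.sum_congr rfl fun k _ => ?_
        rw [← Finset.sum_neg_distrib]
        refine Finset.sum_congr rfl fun m _ => ?_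
        rw [hsymm l m k, hanti y m k]
        ring
      linarith
    unfold nabla4
    simp only [Finset.sum_add_distrib, t1, t2]
    ring
  -- The term k = l vanishes by antisymmetry; the other d + 1 values `l.succAbove s` match the
  -- summands of d^∇.
  rw [hdiv, Fin.sum_univ_succAbove _ l]
  have hz0 : partialD l (fun z => B z l l a b) y = 0 := by
    simp [h0, partialD]
  rw [hz0]
  simp only [h0, mul_zero, Finset.sum_const_zero, add_zero, zero_add]
  unfold phi1Inv extCovD
  rw [Finset.mul_sum, Finset.sum_div]
  refine Finset.sum_congr rfl fun s _ => ?_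
  have e1 : s.removeNth (fun t => (pd (l.succAbove t) : Coord d)) = omitTwo pd l s := rfl
  have e2 : ∀ a m, connMat g y (pd (l.succAbove s)) a m = christoffel g a (l.succAbove s) m y := by
    intro a m
    simp [connMat, pd_apply]
  have hW := differentiableAt_of_contDiffOn hU (hws pd) hy
  have hBd := differentiableAt_of_contDiffOn hU (hBs (l.succAbove s) l a b) hy
  have e3 : fderiv ℝ (fun z => η z (omitTwo pd l s) a b) y (pd (l.succAbove s)) =
      (-1) ^ ((s : ℕ) + (l : ℕ)) *
        (traceGamma g y (l.succAbove s) * w y pd * B y (l.succAbove s) l a b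
          + w y pd * partialD (l.succAbove s) (fun z => B z (l.succAbove s) l a b) y) := by
    rw [← hwpar, ← partialD_mul hW hBd, ← partialD_const_mul (hW.fun_mul hBd)]
    exact partialD_congr hU (fun z hz => hη z hz s a b) hy _
  simp only [e1, e2, e3, hη y hy]
  -- The signs of `phi1Inv`, of `extCovD` and of `phi2Inv` cancel.
  have hc : ((-1 : ℝ) ^ (l : ℕ)) * (-1) ^ (s : ℕ) * (-1) ^ ((s : ℕ) + (l : ℕ)) = 1 := by
    rw [mul_comm ((-1 : ℝ) ^ (l : ℕ)), ← pow_add, ← mul_pow]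
    simp
  have hwy := hw0 y hy
  rw [div_eq_iff hwy]
  have hpull : ∀ (G T : Fin (d + 2) → ℝ),
      ∑ m, G m * ((-1) ^ ((s : ℕ) + (l : ℕ)) * (w y pd * T m)) =
        (-1) ^ ((s : ℕ) + (l : ℕ)) * (w y pd * ∑ m, G m * T m) := by
    intro G T
    simp only [Finset.mul_sum]
    exact Finset.sum_congr rfl fun m _ => by ring
  rw [hpull, hpull]
  linear_combination (w y pd * (partialD (l.succAbove s) (fun z => B z (l.succAbove s) l a b) y
    + traceGamma g y (l.succAbove s) * B y (l.succAbove s) l a b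
        + ∑ m, christoffel g a (l.succAbove s) m y * B y (l.succAbove s) l m b
        + ∑ m, christoffel g b (l.succAbove s) m y * B y (l.succAbove s) l a m)) * hc

/-- Since dw is the connection trace times w, d^∇ becomes ∑_b ℓ_b ∧ i_{∂_b}w, where the one-form ℓ_b
collects the derivatives of F^{lab}. By `sum_mul_cons_removeNth` this equals ∑_b ℓ_b(∂_b) w, a
divergence. -/
theorem extCovD_phi1 (hU : IsOpen U)
    (hw : ∀ z ∈ U, ∃ W : Coord d [⋀^Fin (d + 2)]→ₗ[ℝ] ℝ, ∀ u, w z u = W u)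
    (hws : ∀ u, ContDiffOn ℝ ∞ (fun z => w z u) U) (hy : y ∈ U)
    (hwpar : ∀ r, nablaVol g w y r pd = 0)
    {F : Coord d → Fin (d + 2) → Tens2 d} (hF : ∀ l a b, DifferentiableAt ℝ (fun z => F z l a b) y)
    (u : Fin (d + 2) → Coord d) (l a : Fin (d + 2)) :
    extCovD g (fun z u l a => ∑ b, F z l a b * phi1 (w z) (pd b) u) y u l a =
      w y u * ∑ b, (partialD b (fun z => F z l a b) y + traceGamma g y b * F y l a b
        + ∑ m, christoffel g l b m y * F y m a b + ∑ m, christoffel g a b m y * F y l m b) := by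
  obtain ⟨W, hW⟩ := hw y hy
  set c : Fin (d + 2) → Fin (d + 2) → ℝ := fun b i =>
    partialD i (fun z => F z l a b) y + traceGamma g y i * F y l a b
        + ∑ m, christoffel g l i m y * F y m a b + ∑ m, christoffel g a i m y * F y l m b with hc
  set ℓ : Fin (d + 2) → Coord d →ₗ[ℝ] ℝ := fun b =>
    ∑ i, c b i • (EuclideanSpace.proj i : Coord d →L[ℝ] ℝ).toLinearMap with hℓ
  have hℓX : ∀ b X, ℓ b X = ∑ i, X i * c b i := by
    intro b X
    simp [hℓ, LinearMap.sum_apply, mul_comm]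
  have hterm : ∀ s : Fin (d + 2),
      fderiv ℝ (fun z => ∑ b, F z l a b * phi1 (w z) (pd b) (s.removeNth u)) y (u s)
      + ∑ m, connMat g y (u s) l m * ∑ b, F y m a b * phi1 (w y) (pd b) (s.removeNth u)
      + ∑ m, connMat g y (u s) a m * ∑ b, F y l m b * phi1 (w y) (pd b) (s.removeNth u) =
      ∑ b, ℓ b (u s) * W (Fin.cons (pd b) (s.removeNth u)) := by
    intro s
    have hp : ∀ b, DifferentiableAt ℝ (fun z => phi1 (w z) (pd b) (s.removeNth u)) y := fun b =>
      differentiableAt_of_contDiffOn hU (hws _) hy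
    have hd : ∀ i, partialD i (fun z => ∑ b, F z l a b * phi1 (w z) (pd b) (s.removeNth u)) y =
        ∑ b, (partialD i (fun z => F z l a b) y + traceGamma g y i * F y l a b) *
          phi1 (w y) (pd b) (s.removeNth u) := by
      intro i
      rw [partialD_sum fun b => (hF l a b).fun_mul (hp b)]
      refine Finset.sum_congr rfl fun b _ => ?_
      rw [partialD_mul (hF l a b) (hp b)]
      have : partialD i (fun z => phi1 (w z) (pd b) (s.removeNth u)) y =
          traceGamma g y i * phi1 (w y) (pd b) (s.removeNth u) :=
        partialD_vol hU hw hws hy hwpar i _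
      rw [this]
      ring
    have hφ : ∀ b, phi1 (w y) (pd b) (s.removeNth u) = W (Fin.cons (pd b) (s.removeNth u)) :=
      fun b => hW _
    have hconn : ∀ (a' : Fin (d + 2)) (G : Fin (d + 2) → Fin (d + 2) → ℝ),
        ∑ m, connMat g y (u s) a' m * ∑ b, G m b * W (Fin.cons (pd b) (s.removeNth u)) =
        ∑ b, (∑ i, u s i * ∑ m, christoffel g a' i m y * G m b) *
          W (Fin.cons (pd b) (s.removeNth u)) := by
      intro a' G
      simp only [connMat, Finset.mul_sum, Finset.sum_mul]
      rw [Finset.sum_comm]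
      refine Finset.sum_congr rfl fun b _ => ?_
      rw [Finset.sum_comm]
      exact Finset.sum_congr rfl fun i _ => Finset.sum_congr rfl fun m _ => by ring
    rw [fderiv_eq_sum_partialD]
    simp only [hd, hφ]
    rw [hconn l fun m b => F y m a b, hconn a fun m b => F y l m b]
    simp only [Finset.mul_sum]
    rw [Finset.sum_comm]
    rw [← Finset.sum_add_distrib, ← Finset.sum_add_distrib]
    refine Finset.sum_congr rfl fun b _ => ?_
    rw [hℓX, hc]
    simp only [Finset.sum_mul, mul_add, add_mul, Finset.sum_add_distrib, Finset.mul_sum, mul_assoc]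
  unfold extCovD
  rw [Finset.sum_congr rfl fun s _ => by rw [hterm s, Finset.mul_sum], Finset.sum_comm]
  simp only [sum_mul_cons_removeNth]
  rw [hW, Finset.mul_sum]
  refine Finset.sum_congr rfl fun b _ => ?_
  rw [hℓX, mul_comm]
  congr 1
  simp [pd_apply, hc]

/-- Contractions commute with covariant derivatives. -/
theorem sum_nablaSq4_eq_divergence (hU : IsOpen U)
    (hΓ : ∀ k i j, ContDiffOn ℝ ∞ (christoffel g k i j) U)
    (hsymm : ∀ k i j, christoffel g k i j y = christoffel g k j i y)
    {B : Coord d → Tens4 d} (hB : ∀ a b c e, ContDiffOn ℝ ∞ (fun z => B z a b c e) U)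
    (hy : y ∈ U) {F : Coord d → Fin (d + 2) → Tens2 d}
    (hF : ∀ z l a b, F z l a b = ∑ k, nabla4 g B z k k l a b) (l a : Fin (d + 2)) :
    ∑ b, (partialD b (fun z => F z l a b) y + traceGamma g y b * F y l a b
        + ∑ m, christoffel g l b m y * F y m a b + ∑ m, christoffel g a b m y * F y l m b) =
      ∑ b, ∑ k, nablaSq4 g B y b k k l a b := by
  have hp : ∀ b, partialD b (fun z => F z l a b) y =
      ∑ k, partialD b (fun z => nabla4 g B z k k l a b) y := by
    intro b
    simp only [hF]
    exact partialD_sum (fun k => differentiableAt_of_contDiffOn hU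
      (contDiffOn_nabla4 hU hΓ hB k k l a b) hy) b
  -- The trace term supplies Γ acting on the last slot, the one contracted with the outer
  -- derivative.
  have t1 : ∑ b, traceGamma g y b * F y l a b =
      ∑ b, ∑ k, ∑ m, christoffel g b b m y * nabla4 g B y k k l a m := by
    unfold traceGamma
    simp only [hF, Finset.sum_mul]
    rw [Finset.sum_comm]
    refine Finset.sum_congr rfl fun b _ => ?_
    rw [Finset.sum_comm]
    refine Finset.sum_congr rfl fun m _ => ?_
    rw [hsymm, Finset.mul_sum]
  -- Γ on the contracted upper index k cancels the correction for the contracted covariant index.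
  have t2 : ∀ b, ∑ k, ∑ m, christoffel g k b m y * nabla4 g B y k m l a b =
      ∑ k, ∑ m, christoffel g m b k y * nabla4 g B y m k l a b := fun b => Finset.sum_comm
  have t3 : ∀ (i b : Fin (d + 2)) (T : Fin (d + 2) → Fin (d + 2) → ℝ),
      ∑ m, christoffel g i b m y * ∑ k, T m k = ∑ k, ∑ m, christoffel g i b m y * T m k := by
    intro i b T
    rw [Finset.sum_comm]
    simp only [Finset.mul_sum]
  have hN : ∀ b k, nablaSq4 g B y b k k l a b =
      partialD b (fun z => nabla4 g B z k k l a b) y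
      + ∑ m, (christoffel g k b m y * nabla4 g B y k m l a b
        + christoffel g l b m y * nabla4 g B y k k m a b
        + christoffel g a b m y * nabla4 g B y k k l m b
        + christoffel g b b m y * nabla4 g B y k k l a m)
      - ∑ m, christoffel g m b k y * nabla4 g B y m k l a b := fun _ _ => rfl
  simp only [Finset.sum_add_distrib, Finset.sum_sub_distrib, hN, hp, t1, t2]
  simp only [hF, t3]
  ring

end Divergence

/-! ### The equations in coordinates -/

section Coordinates

variable {U : Set (Coord d)} {g : MetricField d} {v w : VolField d} {β : BField d} {y : Coord d}

theorem phi2Inv_neg (v : (Fin (d + 2) → Coord d) → ℝ) (η : (Fin d → Coord d) → ℝ)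
    (a b : Fin (d + 2)) : phi2Inv v (fun u => -η u) a b = -phi2Inv v η a b := by
  unfold phi2Inv
  rw [← Finset.sum_neg_distrib]
  refine Finset.sum_congr rfl fun l _ => ?_
  rw [← Finset.sum_neg_distrib]
  refine Finset.sum_congr rfl fun k _ => ?_
  split_ifs <;> ring

theorem extCovD_congr (hU : IsOpen U) {k : ℕ} {η θ : Coord d → (Fin k → Coord d) → Tens2 d}
    (h : Set.EqOn η θ U) (hy : y ∈ U) : extCovD g η y = extCovD g θ y := by
  funext u a b
  unfold extCovD
  refine Finset.sum_congr rfl fun s _ => ?_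
  have h1 : (fun z => η z (s.removeNth u) a b) =ᶠ[nhds y] fun z => θ z (s.removeNth u) a b :=
    Filter.eventuallyEq_of_mem (hU.mem_nhds hy) fun z hz => by simp only [h hz]
  rw [h1.fderiv_eq, h hy]

theorem barWedge_eq_zero (hflat : ∀ i j k l, curvature g i j k l y = 0)
    (u : Fin (d + 2) → Coord d) : barWedge g β y u = 0 := by
  have h : ∀ X Y, curvatureEnd g y X Y = 0 := by
    intro X Y
    ext i j
    simp [curvatureEnd, hflat]
  funext a b
  simp [barWedge, h]

/-- The composition `(φ_v¹)⁻¹ ⊗ φ_v¹` does not depend on the volume form `v`. -/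
theorem phi1Inv_mul_phi1 {V W : Coord d [⋀^Fin (d + 2)]→ₗ[ℝ] ℝ} (hV : V pd ≠ 0) (hW : W pd ≠ 0)
    (η : (Fin (d + 1) → Coord d) → ℝ) (l : Fin (d + 2)) (X : Coord d)
    (u : Fin (d + 1) → Coord d) :
    phi1Inv V η l * phi1 V X u = phi1Inv W η l * phi1 W X u := by
  unfold phi1Inv phi1
  rw [map_eq_mul_det V (Fin.cons X u), map_eq_mul_det W (Fin.cons X u)]
  field_simp

theorem contDiffOn_betaTildeSharp (hws : ∀ u, ContDiffOn ℝ ∞ (fun z => w z u) U)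
    (hw0 : ∀ z ∈ U, w z pd ≠ 0)
    (hβs : ∀ u a b, ContDiffOn ℝ ∞ (fun z => betaSharp g β z u a b) U) (a b c e : Fin (d + 2)) :
    ContDiffOn ℝ ∞ (fun z => betaTildeSharp g w β z a b c e) U := by
  unfold betaTildeSharp phi2Inv
  refine ContDiffOn.sum fun l _ => ContDiffOn.sum fun k _ => ?_
  split_ifs <;>
  first
  | exact contDiffOn_const
  | exact (((contDiffOn_const.mul (hβs _ _ _)).div (hws _) hw0).mul contDiffOn_const)

/-- For a flat metric, the Euler–Lagrange operator is the contracted Hessian times the volume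
form. -/
theorem eulerLagrange_eq_mul_contractedHessian (hU : IsOpen U)
    (hs : ∀ X Y, ContDiffOn ℝ ∞ (fun y => g y X Y) U)
    (hsymm : ∀ y ∈ U, ∀ X Y, g y X Y = g y Y X)
    (hnd : ∀ y ∈ U, ∀ X, (∀ Y, g y X Y = 0) → X = 0)
    (hflat : ∀ y ∈ U, ∀ i j k l, curvature g i j k l y = 0)
    (hv : ∀ z ∈ U, ∃ V : Coord d [⋀^Fin (d + 2)]→ₗ[ℝ] ℝ, ∀ u, v z u = V u) (hv0 : ∀ z ∈ U, v z pd ≠ 0)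
    (hw : ∀ z ∈ U, ∃ W : Coord d [⋀^Fin (d + 2)]→ₗ[ℝ] ℝ, ∀ u, w z u = W u) (hw0 : ∀ z ∈ U, w z pd ≠ 0)
    (hws : ∀ u, ContDiffOn ℝ ∞ (fun z => w z u) U)
    (hwpar : ∀ z ∈ U, ∀ r, nablaVol g w z r pd = 0)
    (hβs : ∀ u a b, ContDiffOn ℝ ∞ (fun z => betaSharp g β z u a b) U)
    (hβ : ∀ z ∈ U, ∀ u a b, betaSharp g β z u a b = -betaSharp g β z u b a)
    (hy : y ∈ U) (u : Fin (d + 2) → Coord d) (a e : Fin (d + 2)) :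
    eulerLagrange g v β y u a e = w y u * contractedHessian g w β y a e := by
  have hdet : ∀ y ∈ U, (Matrix.of fun a b => lower g a b y).det ≠ 0 := fun y hy =>
    det_lower_ne_zero (hnd y hy) (hsymm y hy)
  have hΓ := contDiffOn_christoffel hU hs hdet
  have hΓs : ∀ z ∈ U, ∀ k i j, christoffel g k i j z = christoffel g k j i z :=
    fun z hz => christoffel_symm hU hsymm hz
  set B := betaTildeSharp g w β with hBdef
  have hBs := contDiffOn_betaTildeSharp hws hw0 hβs
  set F : Coord d → Fin (d + 2) → Tens2 d := fun z l a b => ∑ k, nabla4 g B z k k l a b with hF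
  have hFd : ∀ l a b, DifferentiableAt ℝ (fun z => F z l a b) y := fun l a b =>
    DifferentiableAt.fun_sum fun k _ =>
      differentiableAt_of_contDiffOn hU (contDiffOn_nabla4 hU hΓ hBs k k l a b) hy
  have homega : Set.EqOn (omega g v β)
      (fun z u l a => ∑ b, F z l a b * phi1 (w z) (pd b) u) U := by
    intro z hz
    funext u l a
    obtain ⟨V, hV⟩ := hv z hz
    obtain ⟨W, hW⟩ := hw z hz
    have hV' : v z = ⇑V := funext hV
    have hW' : w z = ⇑W := funext hW
    have hF' : ∀ b, F z l a b =
        phi1Inv (w z) (fun u => extCovD g (betaSharp g β) z u a b) l := fun b =>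
      (phi1Inv_extCovD hU (hΓs z hz) hws hw0 hz
        (fun r => partialD_vol hU hw hws hz (hwpar z hz) r pd) (betaSharp g β)
        (fun _ _ _ _ _ => rfl) hBs l a b).symm
    unfold omega
    simp only [hF', hV', hW']
    refine Finset.sum_congr rfl fun b _ => phi1Inv_mul_phi1 ?_ ?_ _ _ _ _
    · rw [← hV']
      exact hv0 z hz
    · rw [← hW']
      exact hw0 z hz
  have hext : ∀ l a, extCovD g (omega g v β) y u l a =
      w y u * ∑ r, ∑ s, nablaSq4 g B y r s l r s a := by
    intro l a
    rw [extCovD_congr hU homega hy, extCovD_phi1 hU hw hws hy (hwpar y hy) hFd,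
      sum_nablaSq4_eq_divergence hU hΓ (hΓs y hy) hBs hy fun _ _ _ _ => rfl]
    refine congrArg (fun t => w y u * t) (Finset.sum_comm.trans
      (Finset.sum_congr rfl fun r _ => Finset.sum_congr rfl fun s _ => ?_))
    -- Both pairs are skew, so exchanging within both at once costs no sign.
    have hsw : Set.EqOn B (fun z a b c e => B z b a e c) U := by
      intro z hz
      funext a b c e
      change phi2Inv (w z) (fun u => betaSharp g β z u c e) a b =
        phi2Inv (w z) (fun u => betaSharp g β z u e c) b a
      simp only [hβ z hz _ c e]
      rw [phi2Inv_neg, phi2Inv_swap, neg_neg]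
    rw [nablaSq4_congr hU hsw hy, nablaSq4_swap,
      nablaSq4_comm hU hΓ hBs hy hΓs (hflat y hy)]
  have hhess : ∀ a e, contractedHessian g w β y a e =
      ∑ r, ∑ s, nablaSq4 g B y r s a r s e + ∑ r, ∑ s, nablaSq4 g B y r s e r s a := by
    intro a e
    unfold contractedHessian contr2312
    simp only [← Finset.sum_add_distrib]
    exact Finset.sum_congr rfl fun r _ => Finset.sum_congr rfl fun s _ =>
      nablaSq4_sym14 hU hΓ hBs hy r s a r s e
  unfold eulerLagrange
  rw [barWedge_eq_zero (hflat y hy), zero_add, hhess]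
  simp only [sym12, hext]
  ring

end Coordinates

/-! ### Coordinate expressions of global objects -/

section Charts

variable {N : Type*} [TopologicalSpace N] [ChartedSpace (Coord d) N]
  {e : OpenPartialHomeomorph N (Coord d)} {y : Coord d}

theorem mdifferentiable_of_mem_charts [IsManifold (𝓡 (d + 2)) ∞ N] (he : e ∈ charts d N) :
    e.MDifferentiable (𝓡 (d + 2)) (𝓡 (d + 2)) :=
  ⟨(contMDiffOn_of_mem_maximalAtlas he).mdifferentiableOn (by simp),
    (contMDiffOn_symm_of_mem_maximalAtlas he).mdifferentiableOn (by simp)⟩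

theorem frame_coframe [IsManifold (𝓡 (d + 2)) ∞ N] (he : e ∈ charts d N) (hy : y ∈ e.target)
    (X : TangentSpace (𝓡 (d + 2)) (e.symm y)) : frame e y (coframe e y X) = X := by
  have h := (mdifferentiable_of_mem_charts he).symm_comp_deriv (e.map_target hy)
  have h2 := congrArg (fun L => L X) h
  -- The chain rule gives the derivative of `e.symm` at `e (e.symm y)`; reading it as a map of the
  -- model space lets the base point be changed to `y`.
  have h3 := congrArg (fun z => (mfderiv (𝓡 (d + 2)) (𝓡 (d + 2)) e.symm z :
    Coord d →L[ℝ] Coord d) (coframe e y X)) (e.right_inv hy)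
  exact h3.symm.trans h2

theorem coframe_frame [IsManifold (𝓡 (d + 2)) ∞ N] (he : e ∈ charts d N) (hy : y ∈ e.target)
    (X : Coord d) : coframe e y (frame e y X) = X := by
  have h := (mdifferentiable_of_mem_charts he).comp_symm_deriv hy
  exact congrArg (fun L => L X) h

/-- The coordinate frame as a linear equivalence. -/
def frameEquiv [IsManifold (𝓡 (d + 2)) ∞ N] (he : e ∈ charts d N) (hy : y ∈ e.target) :
    Coord d ≃ₗ[ℝ] TangentSpace (𝓡 (d + 2)) (e.symm y) where
  __ := (frame e y).toLinearMap
  invFun := coframe e y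
  left_inv := coframe_frame he hy
  right_inv := frame_coframe he hy

/-- The frame is an isometry, so the signature carries over. This places the coordinate metric in
the domain where β is assumed smooth. -/
theorem IsMetricForm.metricIn [IsManifold (𝓡 (d + 2)) ∞ N] {p q : ℕ} {g : MetricOn d N}
    (hg : ∀ x, IsMetricForm p q (g x)) (he : e ∈ charts d N) (hy : y ∈ e.target) :
    IsMetricForm p q (metricIn e g y) := by
  have hg' := hg (e.symm y)
  have heq : QuadraticMap.Equivalent
      (LinearMap.BilinMap.toQuadraticMap (BFTheory.metricIn e g y).toBilinForm)
      (LinearMap.BilinMap.toQuadraticMap (g (e.symm y)).toBilinForm) :=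
    ⟨⟨frameEquiv he hy, fun X => rfl⟩⟩
  refine ⟨fun X Y => hg'.symm _ _, fun X hX => ?_, ?_, ?_⟩
  · have h := hg'.nondegenerate (frame e y X) fun Y => by
      rw [← frame_coframe he hy Y]
      exact hX _
    rw [← coframe_frame he hy X, h, map_zero]
  · rw [heq.sigPos_eq, hg'.sigPos_eq]
  · rw [heq.sigNeg_eq, hg'.sigNeg_eq]

/-- The coordinate expression of a top form, as an alternating map. -/
def volInAlternating (e : OpenPartialHomeomorph N (Coord d)) (v : VolOn d N) (y : Coord d) :
    Coord d [⋀^Fin (d + 2)]→ₗ[ℝ] ℝ :=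
  (v (e.symm y)).toAlternatingMap.compLinearMap (frame e y).toLinearMap

theorem volIn_eq (e : OpenPartialHomeomorph N (Coord d)) (v : VolOn d N) (y : Coord d) :
    volIn e v y = volInAlternating e v y := rfl

theorem volIn_pd_ne_zero [IsManifold (𝓡 (d + 2)) ∞ N] {v : VolOn d N} (hv : ∀ x, v x ≠ 0)
    (he : e ∈ charts d N) (hy : y ∈ e.target) : volIn e v y pd ≠ 0 := by
  intro h
  apply hv (e.symm y)
  ext u
  have h1 : volIn e v y (fun s => coframe e y (u s)) = 0 := by
    rw [volIn_eq] at h ⊢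
    rw [map_eq_mul_det, h, zero_mul]
  simpa [volIn, frame_coframe he hy] using h1

theorem metricIn_bIn_skew [IsManifold (𝓡 (d + 2)) ∞ N] {p q : ℕ} {g : MetricOn d N}
    (hg : ∀ x, IsMetricForm p q (g x)) {β : BFormOn d N} (hβ : IsAdjointForm p q β)
    (he : e ∈ charts d N) (hy : y ∈ e.target) (u : Fin d → Coord d) (X Y : Coord d) :
    metricIn e g y (bIn e β y (metricIn e g y) u X) Y
      + metricIn e g y X (bIn e β y (metricIn e g y) u Y) = 0 := by
  -- Thus `bIn` evaluates β at g itself, where skewness is available.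
  have hpull : pullBilin (metricIn e g y) (coframe e y) = g (e.symm y) := by
    ext X Y
    change g (e.symm y) (frame e y (coframe e y X)) (frame e y (coframe e y Y)) = _
    rw [frame_coframe he hy, frame_coframe he hy]
  unfold bIn
  rw [hpull]
  change g (e.symm y) (frame e y (coframe e y _)) (frame e y Y)
    + g (e.symm y) (frame e y X) (frame e y (coframe e y _)) = 0
  rw [frame_coframe he hy, frame_coframe he hy]
  exact hβ.skew _ _ (hg _) _ _ _

/-- Raising the index of a skew-symmetric endomorphism gives a skew-symmetric tensor. -/
theorem betaSharp_skew {g : MetricField d} {β : BField d}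
    (hdet : (Matrix.of fun a b => lower g a b y).det ≠ 0)
    (hsymm : ∀ X Y, g y X Y = g y Y X) (u : Fin d → Coord d)
    (hskew : ∀ X Y, g y (β y (g y) u X) Y + g y X (β y (g y) u Y) = 0) (a b : Fin (d + 2)) :
    betaSharp g β y u a b = -betaSharp g β y u b a := by
  set G : Matrix (Fin (d + 2)) (Fin (d + 2)) ℝ := Matrix.of fun a b => lower g a b y with hG
  set A : Matrix (Fin (d + 2)) (Fin (d + 2)) ℝ :=
    Matrix.of fun i j => β y (g y) u (pd j) i with hA
  have hGt : G.transpose = G := by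
    ext i j
    exact hsymm _ _
  have h1 : A.transpose * G + G * A = 0 := by
    ext i j
    have h := hskew (pd i) (pd j)
    rw [← sum_smul_pd (β y (g y) u (pd i)), ← sum_smul_pd (β y (g y) u (pd j))] at h
    simpa [Matrix.mul_apply, hG, hA, lower, mul_comm] using h
  have hu : IsUnit G.det := isUnit_iff_ne_zero.2 hdet
  -- Multiply AᵀG + GA = 0 by G⁻¹ on both sides.
  have h2 : G⁻¹ * A.transpose + A * G⁻¹ = 0 := by
    have : G⁻¹ * (A.transpose * G + G * A) * G⁻¹ = 0 := by rw [h1]; simp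
    rwa [mul_add, add_mul, ← mul_assoc, Matrix.mul_nonsing_inv_cancel_right _ _ hu, ← mul_assoc,
      Matrix.nonsing_inv_mul _ hu, one_mul] at this
  have h3 : ∀ a b, betaSharp g β y u a b = (G⁻¹ * A.transpose) a b := fun a b => by
    simp [betaSharp, Matrix.mul_apply, upper, hA, hG]
  have h4 : (A * G⁻¹) a b = (G⁻¹ * A.transpose) b a := by
    rw [← Matrix.transpose_apply (A * G⁻¹) b a, Matrix.transpose_mul, Matrix.transpose_nonsing_inv,
      hGt]
  rw [h3, h3, ← h4]
  have := congrFun (congrFun h2 a) b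
  simp only [Matrix.add_apply, Matrix.zero_apply] at this
  linarith

theorem contDiffOn_betaSharp [IsManifold (𝓡 (d + 2)) ∞ N] {p q : ℕ} {g : MetricOn d N}
    (hg : IsPseudoMetric p q g) {β : BFormOn d N} (hβ : IsAdjointForm p q β)
    (he : e ∈ charts d N) (u : Fin d → Coord d) (a b : Fin (d + 2)) :
    ContDiffOn ℝ ∞ (fun z => betaSharp (metricIn e g) (bIn e β) z u a b) e.target := by
  have hm : ∀ z ∈ e.target, IsMetricForm p q (metricIn e g z) := fun z hz =>
    IsMetricForm.metricIn hg.isMetricForm he hz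
  have hgs : ContDiffOn ℝ ∞ (metricIn e g) e.target :=
    contDiffOn_clm_apply.2 fun X => contDiffOn_clm_apply.2 fun Y => hg.smooth e he X Y
  refine ContDiffOn.sum fun m _ => (contDiffOn_upper (hg.smooth e he)
    (fun z hz => det_lower_ne_zero (hm z hz).nondegenerate (hm z hz).symm) _ _).mul ?_
  -- The pull-back g^*β is β along the section z ↦ (z, g(z)).
  have h := (hβ.smooth e he u (pd m)).comp (contDiffOn_id.prodMk hgs)
    fun z hz => ⟨hz, hm z hz⟩
  exact (EuclideanSpace.proj b : Coord d →L[ℝ] ℝ).contDiff.comp_contDiffOn h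

end Charts

end BFTheory

end

theorem mainTheorem9 {d : ℕ} {N : Type*} [TopologicalSpace N]
    [ChartedSpace (BFTheory.Coord d) N] [IsManifold (𝓡 (d + 2)) ∞ N]
    (p q : ℕ) (hpq : p + q = d + 2)
    (v : BFTheory.VolOn d N) (hv : BFTheory.IsVolumeForm v)
    (β : BFTheory.BFormOn d N) (hβ : BFTheory.IsAdjointForm p q β)
    (g : BFTheory.MetricOn d N) (hg : BFTheory.IsPseudoMetric p q g)
    (hflat : BFTheory.IsFlat g)
    (w : BFTheory.VolOn d N) (hw : BFTheory.IsVolumeForm w)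
    (hwpar : BFTheory.IsParallelVol g w) :
    BFTheory.SolvesEulerLagrange g v β ↔ BFTheory.SolvesContractedHessian g w β := by
  have key : ∀ e ∈ BFTheory.charts d N, ∀ y ∈ e.target, ∀ u a b,
      BFTheory.eulerLagrange (BFTheory.metricIn e g) (BFTheory.volIn e v) (BFTheory.bIn e β) y u a b
        = BFTheory.volIn e w y u * BFTheory.contractedHessian (BFTheory.metricIn e g)
            (BFTheory.volIn e w) (BFTheory.bIn e β) y a b := by
    intro e he y hy u a b
    have hm : ∀ z ∈ e.target, BFTheory.IsMetricForm p q (BFTheory.metricIn e g z) :=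
      fun z hz => BFTheory.IsMetricForm.metricIn hg.isMetricForm he hz
    exact BFTheory.eulerLagrange_eq_mul_contractedHessian e.open_target (hg.smooth e he)
      (fun z hz => (hm z hz).symm) (fun z hz => (hm z hz).nondegenerate) (hflat e he)
      (fun z _ => ⟨BFTheory.volInAlternating e v z, fun _ => rfl⟩)
      (fun z hz => BFTheory.volIn_pd_ne_zero hv.ne_zero he hz)
      (fun z _ => ⟨BFTheory.volInAlternating e w z, fun _ => rfl⟩)
      (fun z hz => BFTheory.volIn_pd_ne_zero hw.ne_zero he hz) (hw.smooth e he)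
      (fun z hz r => hwpar e he z hz r _) (BFTheory.contDiffOn_betaSharp hg hβ he)
      (fun z hz u => BFTheory.betaSharp_skew
        (BFTheory.det_lower_ne_zero (hm z hz).nondegenerate (hm z hz).symm) (hm z hz).symm u
        (BFTheory.metricIn_bIn_skew hg.isMetricForm hβ he hz u)) hy u a b
  constructor
  · intro h e he y hy
    funext a b
    -- On the coordinate frame w is nonzero and can be divided out.
    have h1 := key e he y hy BFTheory.pd a b
    rw [h e he y hy] at h1
    exact (mul_eq_zero.1 h1.symm).resolve_left (BFTheory.volIn_pd_ne_zero hw.ne_zero he hy)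
  · intro h e he y hy u
    funext a b
    rw [key e he y hy, h e he y hy]
    exact mul_zero _
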